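/- Let $g$ be a Lorentz inner product on $\mathbb R^4$, i.e. a symmetric real $4\times4$ matrix with $\det g<0$. Let $so(g)=\{L\in\mathbb R^{4\times4}: L^Tg+gL=0\}$ be its Lorentz algebra, whose elements are called Lorentz bivectors, and let $SO^+(g)$ be the connected component of the identity in $\{\Lambda:\Lambda^Tg\Lambda=g,\ \det\Lambda=1\}$. A bivector is simple if it has the form $uv^Tg-vu^Tg$ with $u,v\in\mathbb R^4$, and nonsimple otherwise. A Lorentz transformation is simple if it is $\exp(L)$ for a simple bivector $L$, and nonsimple otherwise. Write ${\rm tr}_2M$ for the coefficient of $t^2$ in $\det(I+tM)$. A nonsimple bivector $L$ has the orthogonal decomposition $L=L_++L_-$, where $$L_\pm=\pm\frac{L^3-\nu_\mp L}{\nu_+-\nu_-},\qquad \nu_\pm=\tfrac12\Bigl(-{\rm tr}_2L\pm\sqrt{({\rm tr}_2L)^2-4\det L}\Bigr);$$ here $L_\pm$ are simple bivectors with $L_+L_-=0=L_-L_+$ and ${\rm tr}_2L_\pm=-\nu_\pm$. **Theorem.** Suppose $\Lambda\in SO^+(g)$ is nonsimple. Put $\Delta=({\rm tr}\,\Lambda)^2-4\,{\rm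 tr}_2\Lambda+8$ and define $\mu_+\ge0\ge\mu_-$ by $$\sqrt{\mu_+}=\cosh^{-1}\tfrac14\bigl({\rm tr}\,\Lambda+\sqrt\Delta\bigr),\qquad \sqrt{-\mu_-}=\cos^{-1}\tfrac14\bigl({\rm tr}\,\Lambda-\sqrt\Delta\bigr).$$ Let $c_+=\cosh\sqrt{\mu_+}$, $c_-=\cos\sqrt{-\mu_-}$, $s_+=\sinh\sqrt{\mu_+}/\sqrt{\mu_+}$ and $s_-=\sin\sqrt{-\mu_-}/\sqrt{-\mu_-}$. If $\mu_-\neq-\pi^2$, then these quantities are well defined (that is, $\Delta\ge0$, $\tfrac14({\rm tr}\,\Lambda+\sqrt\Delta)\ge1$, $\tfrac14({\rm tr}\,\Lambda-\sqrt\Delta)\in[-1,1]$ and $\mu_+>0>\mu_-$), $(c_+-c_-)s_\pm\ne0$, and $\Lambda=\exp(L)$ for a nonsimple Lorentz bivector $L$ whose orthogonal decomposition $L=L_++L_-$ is given by $$L_\pm=\mp\frac{1}{(c_+-c_-)s_\pm}\Bigl\{\tfrac12c_\mp(\Lambda-\Lambda^{-1})-\tfrac14(\Lambda^2-\Lambda^{-2})\Bigr\}.$$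 Moreover, ${\rm tr}_2L_\pm=-\mu_\pm$. -/

import Mathlib

open scoped Matrix

namespace Lorentz

/-- Real `4 × 4` matrices, i.e. linear transformations of `ℝ⁴`. -/
abbrev Mat4 := Matrix (Fin 4) (Fin 4) ℝ

/-- The `k`-th order trace: the coefficient of `t ^ k` in `det (I + t M)`. -/
noncomputable def traceK (k : ℕ) (M : Mat4) : ℝ :=
  (Matrix.det (1 + (Polynomial.X : Polynomial ℝ) • M.map Polynomial.C)).coeff k

/-- A Lorentz inner product on `ℝ⁴`: symmetric with negative determinant
(in particular nondegenerate). -/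
def IsLorentzMetric (g : Mat4) : Prop :=
  gᵀ = g ∧ g.det < 0

/-- The Lorentz algebra `so(g)`; its elements are the Lorentz bivectors. -/
def so (g : Mat4) : Set Mat4 :=
  {L | Lᵀ * g + g * L = 0}

/-- Simple Lorentz bivectors: the matrices `u vᵀ g - v uᵀ g`. -/
def IsSimpleBivector (g L : Mat4) : Prop :=
  ∃ u v : Fin 4 → ℝ, L = Matrix.vecMulVec u v * g - Matrix.vecMulVec v u * g

/-- Nonsimple Lorentz bivectors. -/
def IsNonsimpleBivector (g L : Mat4) : Prop :=
  L ∈ so g ∧ ¬ IsSimpleBivector g L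

/-- `μ₊` of a bivector: the larger root of `x² + (tr₂ L) x + det L`. -/
noncomputable def bivectorMuPlus (L : Mat4) : ℝ :=
  (1 / 2) * (-traceK 2 L + √((traceK 2 L) ^ 2 - 4 * L.det))

/-- `μ₋` of a bivector: the smaller root of `x² + (tr₂ L) x + det L`. -/
noncomputable def bivectorMuMinus (L : Mat4) : ℝ :=
  (1 / 2) * (-traceK 2 L - √((traceK 2 L) ^ 2 - 4 * L.det))

/-- `L = Lp + Lm` is the orthogonal decomposition of the (nonsimple) bivector `L`: the summands are
simple, annihilate each other, are `± (L³ - μ_∓ L) / (μ₊ - μ₋)`, and have second order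
traces `-μ_±`, where `μ_±` are the squared roots of the characteristic polynomial of `L`. -/
structure IsOrthogonalDecomposition (g L Lp Lm : Mat4) : Prop where
  sum_eq : L = Lp + Lm
  simple_plus : IsSimpleBivector g Lp
  simple_minus : IsSimpleBivector g Lm
  plus_mul_minus : Lp * Lm = 0
  minus_mul_plus : Lm * Lp = 0
  plus_eq : Lp = (1 / (bivectorMuPlus L - bivectorMuMinus L)) • (L ^ 3 - bivectorMuMinus L • L)
  minus_eq : Lm = -((1 / (bivectorMuPlus L - bivectorMuMinus L)) • (L ^ 3 - bivectorMuPlus L • L))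
  traceK_plus : traceK 2 Lp = -bivectorMuPlus L
  traceK_minus : traceK 2 Lm = -bivectorMuMinus L

/-- The proper Lorentz transformations: those preserving `g` and having determinant `1`. -/
def SO (g : Mat4) : Set Mat4 :=
  {A | Aᵀ * g * A = g ∧ A.det = 1}

/-- The proper orthochronous Lorentz transformations `SO⁺(g)`: the connected component of the
identity in the group of proper Lorentz transformations. -/
def SOPlus (g : Mat4) : Set Mat4 :=
  connectedComponentIn (SO g) 1

/-- A simple Lorentz transformation is the exponential of a simple Lorentz bivector. -/
def IsSimpleTransformation (g A : Mat4) : Prop :=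
  ∃ L : Mat4, IsSimpleBivector g L ∧ A = NormedSpace.exp L

/-- `Δ = tr² Λ - 4 tr₂ Λ + 8`. -/
noncomputable def disc (A : Mat4) : ℝ :=
  A.trace ^ 2 - 4 * traceK 2 A + 8

/-- `μ₊` of a transformation: `√μ₊ = cosh⁻¹ ((tr Λ + √Δ) / 4)`. -/
noncomputable def muPlus (A : Mat4) : ℝ :=
  (Real.arcosh ((1 / 4) * (A.trace + √(disc A)))) ^ 2

/-- `μ₋` of a transformation: `√(-μ₋) = cos⁻¹ ((tr Λ - √Δ) / 4)`. -/
noncomputable def muMinus (A : Mat4) : ℝ :=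
  -(Real.arccos ((1 / 4) * (A.trace - √(disc A)))) ^ 2

noncomputable def cPlus (A : Mat4) : ℝ := Real.cosh (√(muPlus A))

noncomputable def cMinus (A : Mat4) : ℝ := Real.cos (√(-muMinus A))

noncomputable def sPlus (A : Mat4) : ℝ := Real.sinh (√(muPlus A)) / √(muPlus A)

noncomputable def sMinus (A : Mat4) : ℝ := Real.sin (√(-muMinus A)) / √(-muMinus A)

end Lorentz

namespace Lorentz

/-! Since `A` is similar to the transpose of its inverse, its characteristic polynomial is
palindromic, and Cayley–Hamilton becomes a quadratic equation for `S = A + A⁻¹` with roots `2p`,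
`2q`, where `p, q = (tr A ± √Δ)/4`. For `p ≠ q` the spectral projections `P`, `Q` of `S` commute
with the bivector `B = A - A⁻¹`, and `B² = S² - 4` gives `(PB)² = 4(p² - 1)P`, `(QB)² = 4(q² - 1)Q`.
So `L₊`, `L₋` are multiples of `PB`, `QB`: a hyperbolic and an elliptic rotation generator on
complementary planes. Each satisfies `M³ = τM`, so its exponential is a closed quadratic expression,
and the product of the two exponentials is `A`. The remaining point is `-1 < q < 1 < p`
(`SO.spectral_bounds`). It rests on `det B ≤ 0`, since `gB` is skew with square determinant while
`det g < 0`, and on the fact that `A` is simple when 1 is an eigenvalue and the trace is positive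
(`SO.isSimple_of_det_sub_one`). -/

/-! ### Coefficients of the characteristic polynomial -/

theorem trace_sq_sub_trace_mul_self (M : Mat4) :
    (M.trace ^ 2 - (M * M).trace) / 2 =
      M 0 0 * M 1 1 - M 0 1 * M 1 0 + (M 0 0 * M 2 2 - M 0 2 * M 2 0)
      + (M 0 0 * M 3 3 - M 0 3 * M 3 0) + (M 1 1 * M 2 2 - M 1 2 * M 2 1)
      + (M 1 1 * M 3 3 - M 1 3 * M 3 1) + (M 2 2 * M 3 3 - M 2 3 * M 3 2) := by
  simp only [Matrix.trace, Matrix.diag, Matrix.mul_apply, Fin.sum_univ_four]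
  ring

theorem det_one_add_X_smul (M : Mat4) :
    Matrix.det (1 + (Polynomial.X : Polynomial ℝ) • M.map Polynomial.C) =
      1 + Polynomial.C M.trace * Polynomial.X
        + Polynomial.C ((M.trace ^ 2 - (M * M).trace) / 2) * Polynomial.X ^ 2
        + Polynomial.C M.adjugate.trace * Polynomial.X ^ 3
        + Polynomial.C M.det * Polynomial.X ^ 4 := by
  rw [trace_sq_sub_trace_mul_self]
  simp [Matrix.det_succ_row_zero, Matrix.adjugate_fin_succ_eq_det_submatrix, Matrix.trace,
    Fin.sum_univ_succ, Fin.succAbove, Matrix.one_apply]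
  ring

theorem charpoly_eq (M : Mat4) :
    M.charpoly = Polynomial.X ^ 4 - Polynomial.C M.trace * Polynomial.X ^ 3
        + Polynomial.C ((M.trace ^ 2 - (M * M).trace) / 2) * Polynomial.X ^ 2
        - Polynomial.C M.adjugate.trace * Polynomial.X + Polynomial.C M.det := by
  rw [trace_sq_sub_trace_mul_self]
  simp [Matrix.charpoly, Matrix.charmatrix_apply, Matrix.det_succ_row_zero,
    Matrix.adjugate_fin_succ_eq_det_submatrix, Matrix.trace,
    Fin.sum_univ_succ, Fin.succAbove, Matrix.diagonal_apply]
  ring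

theorem traceK_two (M : Mat4) : traceK 2 M = (M.trace ^ 2 - (M * M).trace) / 2 := by
  rw [traceK, det_one_add_X_smul]
  simp [Polynomial.coeff_one, Polynomial.coeff_X_pow, Polynomial.coeff_C_mul]

/-! ### Skew matrices and the Pfaffian -/

theorem skew_det_sq (W : Mat4) (h : Wᵀ = -W) :
    W.det = (W 0 1 * W 2 3 - W 0 2 * W 1 3 + W 0 3 * W 1 2) ^ 2 := by
  have e : ∀ i j, W j i = - W i j := fun i j => by
    have := congrFun (congrFun h i) j
    simpa using this
  have d : ∀ i, W i i = 0 := fun i => by linarith [e i i]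
  simp [Matrix.det_succ_row_zero, Fin.sum_univ_succ, Fin.succAbove, d, e 0 1, e 0 2, e 0 3,
    e 1 2, e 1 3, e 2 3]
  ring

/-- Vanishing of the Pfaffian is the Plücker relation, which makes `W` decomposable: two rows `i`,
`j` with `W i j ≠ 0` serve as factors after scaling. -/
theorem skew_eq_wedge (W : Mat4) (h : Wᵀ = -W) (hd : W.det = 0) :
    ∃ u v : Fin 4 → ℝ, W = Matrix.vecMulVec u v - Matrix.vecMulVec v u := by
  rw [skew_det_sq W h] at hd
  have hp := pow_eq_zero_iff (two_ne_zero) |>.1 hd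
  have e : ∀ i j, W j i = - W i j := fun i j => by
    have := congrFun (congrFun h i) j
    simpa using this
  have d : ∀ i, W i i = 0 := fun i => by linarith [e i i]
  have plucker : ∀ i j k l, W i j * W k l = W i k * W j l - W i l * W j k := by
    intro i j k l
    fin_cases i <;> fin_cases j <;> fin_cases k <;> fin_cases l <;>
      simp [d, e 0 1, e 0 2, e 0 3, e 1 2, e 1 3, e 2 3] <;> linarith
  by_cases h0 : W = 0
  · exact ⟨0, 0, by simp [h0]⟩
  obtain ⟨i, j, hij⟩ : ∃ i j, W i j ≠ 0 := by
    by_contra! hc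
    exact h0 (by ext i j; simpa using hc i j)
  refine ⟨fun k => W i k / W i j, W j, ?_⟩
  ext k l
  simp only [Matrix.sub_apply, Matrix.vecMulVec_apply]
  field_simp
  linarith [plucker i j k l]

/-! ### Exponentials of elements with `M³ = τM` -/

section Exp

variable {R : Type*} [NormedRing R] [NormedAlgebra ℝ R] [CompleteSpace R]

open Nat in
-- All odd powers are multiples of `M` and all even powers from the second on are multiples of `M²`.
-- Keeping `s` and `e` as sums avoids dividing by `τ`, so `τ = 0` is covered.
theorem exp_eq_of_cube {M : R} {τ s e : ℝ} (hM : M ^ 3 = τ • M)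
    (hs : HasSum (fun k : ℕ => τ ^ k / ((2 * k + 1)! : ℝ)) s)
    (he : HasSum (fun k : ℕ => τ ^ k / ((2 * k + 2)! : ℝ)) e) :
    NormedSpace.exp M = 1 + s • M + e • M ^ 2 := by
  have odd : ∀ k : ℕ, M ^ (2 * k + 1) = τ ^ k • M := by
    intro k
    induction k with
    | zero => simp
    | succ k ih =>
      rw [show 2 * (k + 1) + 1 = (2 * k + 1) + 2 by ring, pow_add, ih, smul_mul_assoc,
        (show M * M ^ 2 = M ^ 3 by noncomm_ring), hM, smul_smul, ← pow_succ]
  have even : ∀ k : ℕ, M ^ (2 * k + 2) = τ ^ k • M ^ 2 := by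
    intro k
    rw [show 2 * k + 2 = (2 * k + 1) + 1 by ring, pow_succ, odd, smul_mul_assoc, sq]
  have h1 : HasSum (fun k : ℕ => ((2 * k + 1)! : ℝ)⁻¹ • M ^ (2 * k + 1)) (s • M) := by
    convert hs.smul_const M using 2 with k
    rw [odd, smul_smul, div_eq_inv_mul]
  have h2 : HasSum (fun k : ℕ => ((2 * k + 1 + 1)! : ℝ)⁻¹ • M ^ (2 * k + 1 + 1)) (e • M ^ 2) := by
    convert he.smul_const (M ^ 2) using 2 with k
    rw [even, smul_smul, div_eq_inv_mul]
  -- The constant term is dropped, so the index shifts by one and odd powers sit at even indices.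
  have h3 := HasSum.even_add_odd (f := fun n : ℕ => ((n + 1)! : ℝ)⁻¹ • M ^ (n + 1)) h1 h2
  have h4 := NormedSpace.exp_series_hasSum_exp' (𝕂 := ℝ) M
  have h5 := (hasSum_nat_add_iff (f := fun n : ℕ => (n ! : ℝ)⁻¹ • M ^ n) 1).1 h3
  rw [h4.unique h5]
  simp
  abel

end Exp

open Nat in
theorem hasSum_hyperbolic {a : ℝ} (ha : a ≠ 0) :
    HasSum (fun k : ℕ => (a ^ 2) ^ k / ((2 * k + 1)! : ℝ)) (Real.sinh a / a) ∧
    HasSum (fun k : ℕ => (a ^ 2) ^ k / ((2 * k + 2)! : ℝ)) ((Real.cosh a - 1) / a ^ 2) := by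
  constructor
  · refine (congrArg (fun f : ℕ → ℝ => HasSum f _) (funext fun k => ?_)).mpr
      ((Real.hasSum_sinh a).div_const a)
    rw [← pow_mul, pow_succ]
    field_simp
  · have h := (hasSum_nat_add_iff' 1).2 (Real.hasSum_cosh a)
    have h' := h.div_const (a ^ 2)
    simp only [Finset.sum_range_one, mul_zero, pow_zero, factorial_zero, cast_one, div_one] at h'
    refine (congrArg (fun f : ℕ → ℝ => HasSum f _) (funext fun k => ?_)).mpr h'
    rw [← pow_mul, mul_add, pow_add]
    field_simp

open Nat in
theorem hasSum_trigonometric {b : ℝ} (hb : b ≠ 0) :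
    HasSum (fun k : ℕ => (-b ^ 2) ^ k / ((2 * k + 1)! : ℝ)) (Real.sin b / b) ∧
    HasSum (fun k : ℕ => (-b ^ 2) ^ k / ((2 * k + 2)! : ℝ)) ((1 - Real.cos b) / b ^ 2) := by
  constructor
  · refine (congrArg (fun f : ℕ → ℝ => HasSum f _) (funext fun k => ?_)).mpr
      ((Real.hasSum_sin b).div_const b)
    rw [neg_pow, ← pow_mul, pow_succ]
    field_simp
  · have h := (hasSum_nat_add_iff' 1).2 (Real.hasSum_cos b)
    have h' := (h.div_const (b ^ 2)).neg
    simp only [Finset.sum_range_one, mul_zero, pow_zero, factorial_zero, cast_one, div_one,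
      mul_one, ← neg_div, neg_sub] at h'
    refine (congrArg (fun f : ℕ → ℝ => HasSum f _) (funext fun k => ?_)).mpr h'
    rw [neg_pow, ← pow_mul, mul_add, pow_add, pow_succ (-1 : ℝ)]
    field_simp
    ring

open Nat in
theorem hasSum_parabolic :
    HasSum (fun k : ℕ => (0 : ℝ) ^ k / ((2 * k + 1)! : ℝ)) 1 ∧
    HasSum (fun k : ℕ => (0 : ℝ) ^ k / ((2 * k + 2)! : ℝ)) (1 / 2) := by
  constructor
  · convert hasSum_single (f := fun k : ℕ => (0 : ℝ) ^ k / ((2 * k + 1)! : ℝ)) 0 ?_ using 1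
    · simp
    · intro k hk
      simp [hk]
  · convert hasSum_single (f := fun k : ℕ => (0 : ℝ) ^ k / ((2 * k + 2)! : ℝ)) 0 ?_ using 1
    · simp
    · intro k hk
      simp [hk]

section
open scoped Matrix.Norms.Operator

open Nat in
theorem matrix_exp_eq_of_cube {M : Mat4} {τ s e : ℝ} (hM : M ^ 3 = τ • M)
    (h : HasSum (fun k : ℕ => τ ^ k / ((2 * k + 1)! : ℝ)) s ∧
      HasSum (fun k : ℕ => τ ^ k / ((2 * k + 2)! : ℝ)) e) :
    NormedSpace.exp M = 1 + s • M + e • M ^ 2 :=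
  exp_eq_of_cube hM h.1 h.2

end

/-! ### Bivectors: trace, determinant, simplicity -/

theorem so_trace {g L : Mat4} (hg : IsLorentzMetric g) (hL : L ∈ so g) : L.trace = 0 := by
  have hu : IsUnit g.det := hg.2.ne.isUnit
  have h : Lᵀ = -(g * L * g⁻¹) := by
    have := eq_neg_of_add_eq_zero_left (show Lᵀ * g + g * L = 0 from hL)
    rw [← Matrix.neg_mul, ← this, Matrix.mul_nonsing_inv_cancel_right _ _ hu]
  have h2 := congrArg Matrix.trace h
  rw [Matrix.trace_transpose, Matrix.trace_neg, Matrix.trace_mul_comm,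
    Matrix.nonsing_inv_mul_cancel_left _ _ hu] at h2
  linarith

theorem so_det_nonpos {g L : Mat4} (hg : IsLorentzMetric g) (hL : L ∈ so g) : L.det ≤ 0 := by
  have h : (g * L)ᵀ = -(g * L) := by
    rw [Matrix.transpose_mul, hg.1]
    exact eq_neg_of_add_eq_zero_left hL
  have h2 := skew_det_sq _ h
  rw [Matrix.det_mul] at h2
  nlinarith [hg.2, sq_nonneg
    ((g * L) 0 1 * (g * L) 2 3 - (g * L) 0 2 * (g * L) 1 3 + (g * L) 0 3 * (g * L) 1 2)]

theorem so_isSimple_of_det {g L : Mat4} (hg : IsLorentzMetric g) (hL : L ∈ so g)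
    (hd : L.det = 0) : IsSimpleBivector g L := by
  have hu : IsUnit g.det := hg.2.ne.isUnit
  have h : (L * g⁻¹)ᵀ = -(L * g⁻¹) := by
    have := eq_neg_of_add_eq_zero_left (show Lᵀ * g + g * L = 0 from hL)
    have h1 : Lᵀ = -(g * L * g⁻¹) := by
      rw [← Matrix.neg_mul, ← this, Matrix.mul_nonsing_inv_cancel_right _ _ hu]
    rw [Matrix.transpose_mul, Matrix.transpose_nonsing_inv, hg.1, h1, Matrix.mul_neg,
      Matrix.mul_assoc, Matrix.nonsing_inv_mul_cancel_left _ _ hu]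
  obtain ⟨u, v, huv⟩ := skew_eq_wedge _ h (by rw [Matrix.det_mul, hd, zero_mul])
  refine ⟨u, v, ?_⟩
  rw [← Matrix.sub_mul, ← huv, Matrix.nonsing_inv_mul_cancel_right _ _ hu]

theorem IsSimpleBivector.det_eq_zero {g L : Mat4} (h : IsSimpleBivector g L) : L.det = 0 := by
  obtain ⟨u, v, rfl⟩ := h
  rw [← Matrix.sub_mul, Matrix.det_mul]
  have : (Matrix.vecMulVec u v - Matrix.vecMulVec v u).det = 0 := by
    simp [Matrix.det_succ_row_zero, Fin.sum_univ_succ, Fin.succAbove, Matrix.vecMulVec_apply]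
    ring
  rw [this, zero_mul]

/-- The range lies in the span of `u` and `v`, so products of the rank-one terms collapse to scalar
multiples of such terms (`key`). -/
theorem IsSimpleBivector.cube {g L : Mat4} (hg : gᵀ = g) (h : IsSimpleBivector g L) :
    L ^ 3 = ((L * L).trace / 2) • L := by
  obtain ⟨u, v, rfl⟩ := h
  have hc : v ⬝ᵥ g *ᵥ u = u ⬝ᵥ g *ᵥ v := by
    rw [Matrix.dotProduct_mulVec, ← Matrix.mulVec_transpose, hg, dotProduct_comm]
  have key : ∀ a b c d : Fin 4 → ℝ, Matrix.vecMulVec a b * g * (Matrix.vecMulVec c d * g) =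
      (b ⬝ᵥ g *ᵥ c) • (Matrix.vecMulVec a d * g) := by
    intro a b c d
    rw [← Matrix.mul_assoc, Matrix.mul_assoc (Matrix.vecMulVec a b), Matrix.mul_vecMulVec,
      Matrix.vecMulVec_mul_vecMulVec]
    ext i j
    simp [Matrix.mul_apply, Matrix.vecMulVec_apply, Finset.mul_sum]
    ring_nf
  have tr : ∀ a b : Fin 4 → ℝ, (Matrix.vecMulVec a b * g).trace = b ⬝ᵥ g *ᵥ a := by
    intro a b
    rw [Matrix.trace_mul_comm, Matrix.mul_vecMulVec, Matrix.trace_vecMulVec, dotProduct_comm]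
  simp only [pow_succ, pow_zero, one_mul, sub_mul, mul_sub, key, smul_mul_assoc,
    Matrix.trace_sub, Matrix.trace_smul, tr, hc, smul_eq_mul, smul_sub, smul_smul]
  match_scalars <;> ring

/-! ### Lorentz transformations -/

section SO

variable {g A : Mat4}

theorem SO.isUnit_det (hA : A ∈ SO g) : IsUnit A.det := by
  rw [hA.2]; exact isUnit_one

theorem SO.transpose_mul (hA : A ∈ SO g) : Aᵀ * g = g * A⁻¹ := by
  have h := congrArg (· * A⁻¹) hA.1
  simpa only [Matrix.mul_nonsing_inv_cancel_right _ _ (SO.isUnit_det hA)] using h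

theorem SO.transpose_inv_mul (hA : A ∈ SO g) : (A⁻¹)ᵀ * g = g * A := by
  have hu : IsUnit Aᵀ.det := by rw [Matrix.det_transpose]; exact SO.isUnit_det hA
  have h := congrArg ((A⁻¹)ᵀ * ·) hA.1
  simp only [Matrix.mul_assoc] at h
  rw [← h, Matrix.transpose_nonsing_inv, Matrix.nonsing_inv_mul_cancel_left _ _ hu]

theorem SO.transpose_eq (hg : IsLorentzMetric g) (hA : A ∈ SO g) : Aᵀ = g * A⁻¹ * g⁻¹ := by
  rw [← SO.transpose_mul hA, Matrix.mul_nonsing_inv_cancel_right _ _ hg.2.ne.isUnit]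

theorem SO.trace_inv (hg : IsLorentzMetric g) (hA : A ∈ SO g) : A⁻¹.trace = A.trace := by
  rw [← Matrix.trace_transpose A, SO.transpose_eq hg hA, Matrix.trace_mul_comm,
    Matrix.nonsing_inv_mul_cancel_left _ _ hg.2.ne.isUnit]

theorem SO.trace_adjugate (hg : IsLorentzMetric g) (hA : A ∈ SO g) :
    A.adjugate.trace = A.trace := by
  rw [← SO.trace_inv hg hA, Matrix.inv_def, hA.2]
  simp

theorem SO.charpoly_eq (hg : IsLorentzMetric g) (hA : A ∈ SO g) :
    A.charpoly = Polynomial.X ^ 4 - Polynomial.C A.trace * Polynomial.X ^ 3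
      + Polynomial.C (traceK 2 A) * Polynomial.X ^ 2
      - Polynomial.C A.trace * Polynomial.X + 1 := by
  rw [Lorentz.charpoly_eq, traceK_two, SO.trace_adjugate hg hA, hA.2, Polynomial.C_1]

/-- Cayley–Hamilton for the palindromic polynomial, multiplied by `A⁻²`. -/
theorem SO.add_inv_sq (hg : IsLorentzMetric g) (hA : A ∈ SO g) :
    (A + A⁻¹) * (A + A⁻¹) = A.trace • (A + A⁻¹) - (traceK 2 A - 2) • (1 : Mat4) := by
  have h := Matrix.aeval_self_charpoly A
  rw [SO.charpoly_eq hg hA] at h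
  simp only [map_add, map_sub, map_mul, map_pow, Polynomial.aeval_X, Polynomial.aeval_C, map_one,
    Algebra.algebraMap_eq_smul_one, smul_mul_assoc, one_mul] at h
  have h1 : A * A⁻¹ = 1 := Matrix.mul_nonsing_inv _ (SO.isUnit_det hA)
  have h2 : A⁻¹ * A = 1 := Matrix.nonsing_inv_mul _ (SO.isUnit_det hA)
  have h3 := congrArg (· * (A⁻¹ * A⁻¹)) h
  have e2 : A ^ 2 * (A⁻¹ * A⁻¹) = 1 := by
    rw [sq, Matrix.mul_assoc, ← Matrix.mul_assoc A A⁻¹, h1, Matrix.one_mul, h1]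
  have e1 : A * (A⁻¹ * A⁻¹) = A⁻¹ := by rw [← Matrix.mul_assoc, h1, Matrix.one_mul]
  have e3 : A ^ 3 * (A⁻¹ * A⁻¹) = A := by rw [pow_succ', Matrix.mul_assoc, e2, Matrix.mul_one]
  have e4 : A ^ 4 * (A⁻¹ * A⁻¹) = A * A := by rw [pow_succ', Matrix.mul_assoc, e3]
  simp only [add_mul, sub_mul, smul_mul_assoc, e1, e2, e3, e4, one_mul, zero_mul] at h3
  rw [mul_add, add_mul, add_mul, h1, h2]
  rw [← sub_eq_zero, ← h3]
  module

theorem SO.det_sub_one (hg : IsLorentzMetric g) (hA : A ∈ SO g) :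
    (A - 1).det = 2 - 2 * A.trace + traceK 2 A := by
  have h := Matrix.eval_charpoly A 1
  rw [SO.charpoly_eq hg hA, map_one, ← neg_sub A 1, Matrix.det_neg] at h
  simp at h
  linarith

theorem SO.det_add_one (hg : IsLorentzMetric g) (hA : A ∈ SO g) :
    (A + 1).det = 2 + 2 * A.trace + traceK 2 A := by
  have h := Matrix.eval_charpoly A (-1)
  rw [SO.charpoly_eq hg hA, map_neg, map_one, show -1 - A = -(A + 1) by abel, Matrix.det_neg] at h
  simp at h
  linarith

theorem SO.det_sub_inv (hA : A ∈ SO g) : (A - A⁻¹).det = (A - 1).det * (A + 1).det := by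
  have h1 : A⁻¹ * A = 1 := Matrix.nonsing_inv_mul _ (SO.isUnit_det hA)
  rw [← mul_one (A - A⁻¹).det, ← hA.2, ← Matrix.det_mul, ← Matrix.det_mul, sub_mul, h1]
  congr 1
  noncomm_ring

theorem SO.sub_inv_mem_so (hA : A ∈ SO g) : A - A⁻¹ ∈ so g := by
  change _ = _
  rw [Matrix.transpose_sub, sub_mul, SO.transpose_mul hA, SO.transpose_inv_mul hA]
  noncomm_ring

/-- A `g`-selfadjoint factor times a commuting `g`-skew one is `g`-skew. With `c = 2q` and `c = 2p`
these are multiples of `L₊` and `L₋`. -/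
theorem SO.selfadjoint_mul_sub_inv_mem_so (hA : A ∈ SO g) (c : ℝ) :
    (A + A⁻¹ - c • 1) * (A - A⁻¹) ∈ so g := by
  have h1 : A * A⁻¹ = 1 := Matrix.mul_nonsing_inv _ (SO.isUnit_det hA)
  have h2 : A⁻¹ * A = 1 := Matrix.nonsing_inv_mul _ (SO.isUnit_det hA)
  have k : (A - A⁻¹) * (A + A⁻¹ - c • 1) = (A + A⁻¹ - c • 1) * (A - A⁻¹) := by
    simp only [mul_add, add_mul, mul_sub, sub_mul, h1, h2, smul_mul_assoc, mul_smul_comm, one_mul,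
      mul_one]
    module
  have e : (A - A⁻¹)ᵀ * g = - (g * (A - A⁻¹)) :=
    eq_neg_of_add_eq_zero_left (SO.sub_inv_mem_so hA)
  have f : (A + A⁻¹ - c • 1)ᵀ * g = g * (A + A⁻¹ - c • 1) := by
    rw [Matrix.transpose_sub, Matrix.transpose_add, sub_mul, add_mul, SO.transpose_mul hA,
      SO.transpose_inv_mul hA, Matrix.transpose_smul, Matrix.transpose_one, mul_sub, mul_add,
      smul_mul_assoc, mul_smul_comm, one_mul, mul_one, add_comm (g * A)]
  change _ = _
  rw [Matrix.transpose_mul, Matrix.mul_assoc, f, ← Matrix.mul_assoc, e, Matrix.neg_mul,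
    Matrix.mul_assoc, k, neg_add_cancel]

theorem so_smul {L : Mat4} (c : ℝ) (hL : L ∈ so g) : c • L ∈ so g := by
  change _ = _
  rw [Matrix.transpose_smul, smul_mul_assoc, mul_smul_comm, ← smul_add,
    show Lᵀ * g + g * L = 0 from hL, smul_zero]

/-- `1` being an eigenvalue forces a transformation of positive trace to be simple. -/
theorem SO.isSimple_of_det_sub_one (hg : IsLorentzMetric g) (hA : A ∈ SO g)
    (hd : (A - 1).det = 0) (hc : 0 < A.trace) :
    IsSimpleTransformation g A := by
  -- The roots of the quadratic for `A + A⁻¹` are 2 and `2c`. Projections are unavailable when `c =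
  -- 1`, so the simplicity of `B` supplies the cubic relation instead.
  set c := A.trace / 2 - 1 with hcdef
  have ht : A.trace = 2 + 2 * c := by rw [hcdef]; ring
  have ht2 : traceK 2 A = 4 * c + 2 := by linarith [SO.det_sub_one hg hA]
  have hc1 : 1 + c ≠ 0 := by linarith
  have h1 : A * A⁻¹ = 1 := Matrix.mul_nonsing_inv _ (SO.isUnit_det hA)
  have h2 : A⁻¹ * A = 1 := Matrix.nonsing_inv_mul _ (SO.isUnit_det hA)
  have hS := SO.add_inv_sq hg hA
  obtain ⟨B, hB⟩ : ∃ B, B = (1 / 2 : ℝ) • (A - A⁻¹) := ⟨_, rfl⟩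
  obtain ⟨S, hSd⟩ : ∃ S, S = (1 / 2 : ℝ) • (A + A⁻¹) := ⟨_, rfl⟩
  have hAS : A = B + S := by rw [hB, hSd]; module
  have hSS : S * S = (1 + c) • S - c • (1 : Mat4) := by
    rw [hSd, smul_mul_smul_comm, hS, ht, ht2]; module
  have hBB : B * B = (1 + c) • (S - 1) := by
    have : B * B = S * S - 1 := by
      rw [hB, hSd, smul_mul_smul_comm, smul_mul_smul_comm, mul_add, add_mul, add_mul, mul_sub,
        sub_mul, sub_mul, h1, h2]
      module
    rw [this, hSS]; module
  have hso : B ∈ so g := hB ▸ so_smul _ (SO.sub_inv_mem_so hA)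
  have hdet : B.det = 0 := by
    rw [hB, Matrix.det_smul, SO.det_sub_inv hA, hd]; simp
  have hsimple : IsSimpleBivector g B := so_isSimple_of_det hg hso hdet
  have htr : (B * B).trace / 2 = c ^ 2 - 1 := by
    rw [hBB, Matrix.trace_smul, Matrix.trace_sub, hSd, Matrix.trace_smul, Matrix.trace_add,
      SO.trace_inv hg hA, ht]
    simp; ring
  have hcube := hsimple.cube hg.1
  rw [htr] at hcube
  have hBS : B * S = c • B := by
    have e : B ^ 3 = (1 + c) • (B * S) - (1 + c) • B := by
      rw [pow_succ', sq, hBB, mul_smul_comm, mul_sub, mul_one, smul_sub]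
    have e2 : (1 + c) • (B * S) = (1 + c) • (c • B) := by
      rw [eq_add_of_sub_eq e.symm, hcube]; module
    exact smul_right_injective _ hc1 e2
  have hA2 : A = 1 + B + (1 / (1 + c)) • B ^ 2 := by
    rw [sq, hBB, smul_smul, one_div_mul_cancel hc1, one_smul, hAS]; abel
  -- Seek the logarithm as `f • B`, matching its exponential with `hA2`. The cases `c < 1`, `c = 1`,
  -- `c > 1` are elliptic, parabolic and hyperbolic.
  have main : ∀ f τ s e : ℝ, f ^ 2 * (c ^ 2 - 1) = τ → f * s = 1 → f ^ 2 * e = 1 / (1 + c) →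
      (HasSum (fun k : ℕ => τ ^ k / ((2 * k + 1).factorial : ℝ)) s ∧
      HasSum (fun k : ℕ => τ ^ k / ((2 * k + 2).factorial : ℝ)) e) →
      IsSimpleTransformation g A := by
    intro f τ s e hτ hs he hsum
    refine ⟨f • B, so_isSimple_of_det hg (so_smul _ hso) (by rw [Matrix.det_smul, hdet, mul_zero]),
      ?_⟩
    have h3 : (f • B) ^ 3 = τ • (f • B) := by
      rw [smul_pow, hcube, smul_smul, smul_smul, ← hτ]; ring_nf
    rw [matrix_exp_eq_of_cube h3 hsum, smul_pow, smul_smul, smul_smul, mul_comm s, hs,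
      mul_comm e, he, one_smul]
    exact hA2
  rcases lt_trichotomy c 1 with hlt | heq | hgt
  · have hb : 0 < Real.arccos c := Real.arccos_pos.2 hlt
    have hcos : Real.cos (Real.arccos c) = c := Real.cos_arccos (by linarith) hlt.le
    have hsin : 0 < Real.sin (Real.arccos c) := Real.sin_pos_of_pos_of_lt_pi hb
      (lt_of_le_of_ne (Real.arccos_le_pi c) fun h => by
        have := Real.arccos_eq_pi.1 h; linarith)
    have hsc := Real.sin_sq_add_cos_sq (Real.arccos c)
    rw [hcos] at hsc
    refine main (Real.arccos c / Real.sin (Real.arccos c)) _ _ _ ?_ ?_ ?_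
      (hasSum_trigonometric hb.ne')
    · field_simp; linarith
    · field_simp
    · rw [hcos]; field_simp; linarith
  · refine main 1 _ _ _ ?_ ?_ ?_ hasSum_parabolic <;> norm_num [heq]
  · have ha : 0 < Real.arcosh c := Real.arcosh_pos hgt
    have hcosh : Real.cosh (Real.arcosh c) = c := Real.cosh_arcosh hgt.le
    have hsinh : 0 < Real.sinh (Real.arcosh c) := Real.sinh_pos_iff.2 ha
    have hsc := Real.cosh_sq (Real.arcosh c)
    rw [hcosh] at hsc
    refine main (Real.arcosh c / Real.sinh (Real.arcosh c)) _ _ _ ?_ ?_ ?_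
      (hasSum_hyperbolic ha.ne')
    · field_simp; linarith
    · field_simp
    · rw [hcosh]; field_simp; linarith

end SO

/-! ### Spectral projections and the orthogonal decomposition -/

/-- Spectral projections of `A + A⁻¹`, which commute with `A - A⁻¹`. -/
theorem SO.exists_projections {g A : Mat4} (hg : IsLorentzMetric g) (hA : A ∈ SO g) {p q : ℝ}
    (hpq : p ≠ q) (ht : A.trace = 2 * p + 2 * q) (ht2 : traceK 2 A = 2 + 4 * (p * q)) :
    ∃ P Q : Mat4, P = (1 / (2 * (p - q))) • (A + A⁻¹ - (2 * q) • (1 : Mat4)) ∧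
      Q = (-(1 / (2 * (p - q)))) • (A + A⁻¹ - (2 * p) • (1 : Mat4)) ∧
      P + Q = 1 ∧ P * Q = 0 ∧ Q * P = 0 ∧
      Commute P (A - A⁻¹) ∧ Commute Q (A - A⁻¹) ∧
      A + A⁻¹ = (2 * p) • P + (2 * q) • Q ∧
      (A - A⁻¹) * (A - A⁻¹) = (4 * p ^ 2 - 4) • P + (4 * q ^ 2 - 4) • Q ∧
      P.trace = 2 ∧ Q.trace = 2 := by
  have h1 : A * A⁻¹ = 1 := Matrix.mul_nonsing_inv _ (SO.isUnit_det hA)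
  have h2 : A⁻¹ * A = 1 := Matrix.nonsing_inv_mul _ (SO.isUnit_det hA)
  have hS := SO.add_inv_sq hg hA
  rw [ht, ht2] at hS
  have hd : p - q ≠ 0 := sub_ne_zero.2 hpq
  have hcomm : Commute (A + A⁻¹) (A - A⁻¹) := by
    change _ = _
    simp only [mul_add, add_mul, mul_sub, sub_mul, h1, h2]
    abel
  have hBB : (A - A⁻¹) * (A - A⁻¹) = (A + A⁻¹) * (A + A⁻¹) - (4 : ℝ) • 1 := by
    simp only [mul_add, add_mul, mul_sub, sub_mul, h1, h2]
    module
  have htr : (A + A⁻¹).trace = 4 * p + 4 * q := by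
    rw [Matrix.trace_add, SO.trace_inv hg hA, ht]; ring
  have hone : (1 : Mat4).trace = 4 := by simp
  rw [hBB]
  generalize A + A⁻¹ = S at *
  refine ⟨_, _, rfl, rfl, ?_, ?_, ?_, ?_, ?_, ?_, ?_, ?_, ?_⟩
  · match_scalars <;> field_simp <;> ring
  · rw [smul_mul_smul_comm]
    simp only [mul_sub, sub_mul, hS, smul_mul_assoc, mul_smul_comm, one_mul, mul_one]
    module
  · rw [smul_mul_smul_comm]
    simp only [mul_sub, sub_mul, hS, smul_mul_assoc, mul_smul_comm, one_mul, mul_one]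
    module
  · exact (hcomm.sub_left ((Commute.one_left _).smul_left _)).smul_left _
  · exact (hcomm.sub_left ((Commute.one_left _).smul_left _)).smul_left _
  · match_scalars <;> field_simp <;> ring
  · rw [hS]
    match_scalars <;> field_simp <;> ring
  · rw [Matrix.trace_smul, Matrix.trace_sub, Matrix.trace_smul, htr, hone, smul_eq_mul, smul_eq_mul]
    field_simp; ring
  · rw [Matrix.trace_smul, Matrix.trace_sub, Matrix.trace_smul, htr, hone, smul_eq_mul, smul_eq_mul]
    field_simp; ring

theorem isOrthogonalDecomposition_of_projections {g Lp Lm P Q : Mat4} {m n : ℝ}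
    (hg : IsLorentzMetric g) (hm : 0 < m) (hn : n < 0)
    (hLp : Lp ∈ so g) (hLm : Lm ∈ so g) (hpm : Lp * Lm = 0) (hmp : Lm * Lp = 0)
    (hPQ : P * Q = 0) (hQP : Q * P = 0) (hsum : P + Q = 1)
    (hpp : Lp * Lp = m • P) (hmm : Lm * Lm = n • Q)
    (hP : Lp * P = Lp) (hQ : Lm * Q = Lm)
    (hPt : P.trace = 2) (hQt : Q.trace = 2) :
    IsNonsimpleBivector g (Lp + Lm) ∧ IsOrthogonalDecomposition g (Lp + Lm) Lp Lm ∧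
      traceK 2 Lp = -m ∧ traceK 2 Lm = -n := by
  have hPP : P * P = P := by
    have := congrArg (P * ·) hsum
    simpa [mul_add, hPQ] using this
  have hpQ : Lp * Q = 0 := by rw [← hP, Matrix.mul_assoc, hPQ, mul_zero]
  have hmP : Lm * P = 0 := by rw [← hQ, Matrix.mul_assoc, hQP, mul_zero]
  have hso : Lp + Lm ∈ so g := by
    change _ = _
    rw [Matrix.transpose_add, add_mul, mul_add, add_add_add_comm,
      show Lpᵀ * g + g * Lp = 0 from hLp, show Lmᵀ * g + g * Lm = 0 from hLm, add_zero]
  have hkp : traceK 2 Lp = -m := by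
    rw [traceK_two, so_trace hg hLp, hpp, Matrix.trace_smul, hPt, smul_eq_mul]; ring
  have hkm : traceK 2 Lm = -n := by
    rw [traceK_two, so_trace hg hLm, hmm, Matrix.trace_smul, hQt, smul_eq_mul]; ring
  have hLL : (Lp + Lm) ^ 2 = m • P + n • Q := by
    rw [sq, mul_add, add_mul, add_mul, hpm, hmp, hpp, hmm, add_zero, zero_add]
  have hL3 : (Lp + Lm) ^ 3 = m • Lp + n • Lm := by
    rw [pow_succ', hLL]
    simp only [add_mul, mul_add, mul_smul_comm, hP, hQ, hpQ, hmP, add_zero, zero_add]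
  have hk : ((Lp + Lm).trace ^ 2 - ((Lp + Lm) * (Lp + Lm)).trace) / 2 = -(m + n) := by
    rw [so_trace hg hso, ← sq, hLL, Matrix.trace_add, Matrix.trace_smul, Matrix.trace_smul, hPt,
      hQt, smul_eq_mul, smul_eq_mul]
    ring
  -- Cayley–Hamilton multiplied by `P` and traced: the linear term drops because `Lp` is traceless,
  -- leaving an equation for the determinant.
  have hdet : (Lp + Lm).det = m * n := by
    have h := Matrix.aeval_self_charpoly (Lp + Lm)
    rw [charpoly_eq, hk, so_trace hg hso] at h
    simp only [map_add, map_sub, map_mul, map_pow, Polynomial.aeval_X, Polynomial.aeval_C,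
      Algebra.algebraMap_eq_smul_one, smul_mul_assoc, one_mul, zero_smul] at h
    have h' := congrArg (fun M => (M * P).trace) h
    have e4 : (Lp + Lm) ^ 4 * P = m ^ 2 • P := by
      rw [show (Lp + Lm) ^ 4 = (Lp + Lm) ^ 2 * (Lp + Lm) ^ 2 by noncomm_ring, hLL, Matrix.mul_assoc,
        add_mul (m • P) _ P, smul_mul_assoc, smul_mul_assoc, hPP, hQP, smul_zero, add_zero,
        add_mul, smul_mul_smul_comm, smul_mul_smul_comm, hPP, hQP, smul_zero, add_zero, sq]
    have e2 : (Lp + Lm) ^ 2 * P = m • P := by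
      rw [hLL, add_mul, smul_mul_assoc, smul_mul_assoc, hPP, hQP, smul_zero, add_zero]
    have e1 : (Lp + Lm) * P = Lp := by rw [add_mul, hP, hmP, add_zero]
    simp only [add_mul, sub_mul, smul_mul_assoc, e4, e2, one_mul, Matrix.zero_mul] at h'
    simp only [← add_mul, e1, Matrix.trace_add, Matrix.trace_sub, Matrix.trace_smul, hPt,
      so_trace hg hLp, Matrix.trace_zero, smul_eq_mul] at h'
    linarith
  -- An invertible `Lp` would force `Lm = 0`, but `Lm²` has trace `2n ≠ 0`.
  have hdp : Lp.det = 0 := by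
    by_contra hne
    have h0 : Lm = 0 := by
      rw [← Matrix.nonsing_inv_mul_cancel_left Lp Lm (isUnit_iff_ne_zero.2 hne), hpm, mul_zero]
    rw [h0, mul_zero] at hmm
    have := congrArg Matrix.trace hmm
    rw [Matrix.trace_smul, hQt, smul_eq_mul, Matrix.trace_zero] at this
    linarith
  have hdm : Lm.det = 0 := by
    by_contra hne
    have h0 : Lp = 0 := by
      rw [← Matrix.nonsing_inv_mul_cancel_left Lm Lp (isUnit_iff_ne_zero.2 hne), hmp, mul_zero]
    rw [h0, mul_zero] at hpp
    have := congrArg Matrix.trace hpp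
    rw [Matrix.trace_smul, hPt, smul_eq_mul, Matrix.trace_zero] at this
    linarith
  have hsqrt : √((-(m + n)) ^ 2 - 4 * (m * n)) = m - n := by
    rw [show (-(m + n)) ^ 2 - 4 * (m * n) = (m - n) ^ 2 by ring, Real.sqrt_sq (by linarith)]
  have hmup : bivectorMuPlus (Lp + Lm) = m := by
    rw [bivectorMuPlus, traceK_two, hk, hdet, hsqrt]; ring
  have hmum : bivectorMuMinus (Lp + Lm) = n := by
    rw [bivectorMuMinus, traceK_two, hk, hdet, hsqrt]; ring
  have hne : m - n ≠ 0 := by linarith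
  refine ⟨⟨hso, fun h => ?_⟩, ⟨rfl, so_isSimple_of_det hg hLp hdp, so_isSimple_of_det hg hLm hdm,
    hpm, hmp, ?_, ?_, ?_, ?_⟩, hkp, hkm⟩
  · rw [h.det_eq_zero] at hdet
    nlinarith
  · rw [hmup, hmum, hL3]
    match_scalars <;> field_simp
    ring
  · rw [hmup, hmum, hL3]
    match_scalars <;> field_simp <;> ring
  · rw [hmup, hkp]
  · rw [hmum, hkm]

/-- `det (A ∓ 1) = 4(1 ∓ p)(1 ∓ q)`, and the product of the two is `det (A - A⁻¹) ≤ 0`. Once `q >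
-1`, the factor `det (A + 1)` is positive, so `(1 - p)(1 - q) ≤ 0`; equality would make `A` simple.
-/
theorem SO.spectral_bounds {g A : Mat4} (hg : IsLorentzMetric g) (hA : A ∈ SO g)
    (hns : ¬ IsSimpleTransformation g A) (hmu : muMinus A ≠ -Real.pi ^ 2) :
    0 ≤ disc A ∧ 1 < (1 / 4) * (A.trace + √(disc A)) ∧
      -1 < (1 / 4) * (A.trace - √(disc A)) ∧ (1 / 4) * (A.trace - √(disc A)) < 1 ∧
      traceK 2 A = 2 + 4 * ((1 / 4) * (A.trace + √(disc A)) * ((1 / 4) * (A.trace - √(disc A)))) := by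
  have hprod : (A - 1).det * (A + 1).det ≤ 0 := by
    rw [← SO.det_sub_inv hA]
    exact so_det_nonpos hg (SO.sub_inv_mem_so hA)
  have hd1 := SO.det_sub_one hg hA
  have hd2 := SO.det_add_one hg hA
  have hdisc : 0 ≤ disc A := by
    rw [hd1, hd2] at hprod
    rw [disc]
    -- The product bound reads `4 tr² ≥ (tr₂ + 2)²`, whence `4Δ ≥ (tr₂ - 6)²`.
    nlinarith [sq_nonneg (traceK 2 A - 6)]
  have hsq := Real.sq_sqrt hdisc
  have hnn := Real.sqrt_nonneg (disc A)
  -- `arccos` takes the value `π` on all of `(-∞, -1]`, so the hypothesis on `μ₋` excludes that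
  -- whole ray.
  have hq : -1 < (1 / 4) * (A.trace - √(disc A)) := by
    by_contra! h
    exact hmu (by rw [muMinus, Real.arccos_eq_pi.2 h])
  have hk : traceK 2 A =
      2 + 4 * ((1 / 4) * (A.trace + √(disc A)) * ((1 / 4) * (A.trace - √(disc A)))) := by
    have : disc A = A.trace ^ 2 - 4 * traceK 2 A + 8 := rfl
    linear_combination (1 / 4) * this + (1 / 4) * hsq
  obtain ⟨p, hp⟩ : ∃ p, p = (1 / 4) * (A.trace + √(disc A)) := ⟨_, rfl⟩
  obtain ⟨q, hq'⟩ : ∃ q, q = (1 / 4) * (A.trace - √(disc A)) := ⟨_, rfl⟩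
  have ht : A.trace = 2 * p + 2 * q := by rw [hp, hq']; ring
  have hle : q ≤ p := by rw [hp, hq']; linarith
  rw [← hq'] at hq
  rw [← hp, ← hq'] at hk ⊢
  have e1 : (A - 1).det = 4 * ((1 - p) * (1 - q)) := by rw [hd1, hk, ht]; ring
  have e2 : (A + 1).det = 4 * ((1 + p) * (1 + q)) := by rw [hd2, hk, ht]; ring
  have hpos : 0 < (A + 1).det := by
    rw [e2]
    have := mul_pos (show 0 < 1 + p by linarith) (show 0 < 1 + q by linarith)
    linarith
  have hneg : (1 - p) * (1 - q) ≤ 0 := by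
    by_contra! h
    exact absurd hprod (not_le.2 (mul_pos (by rw [e1]; linarith) hpos))
  have hne : (1 - p) * (1 - q) ≠ 0 := by
    intro h0
    refine hns (SO.isSimple_of_det_sub_one hg hA (by rw [e1, h0, mul_zero]) ?_)
    rcases mul_eq_zero.1 h0 with h | h <;> linarith
  have hlt : (1 - p) * (1 - q) < 0 := lt_of_le_of_ne hneg hne
  refine ⟨hdisc, ?_, hq, ?_, hk⟩
  · by_contra! h
    nlinarith [mul_nonneg (show 0 ≤ 1 - p by linarith) (show 0 ≤ 1 - q by linarith)]
  · by_contra! h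
    nlinarith [mul_nonneg (show 0 ≤ p - 1 by linarith) (show 0 ≤ q - 1 by linarith)]

end Lorentz

/-! ### The logarithm -/

theorem mainTheorem4 (g : Lorentz.Mat4) (hg : Lorentz.IsLorentzMetric g)
    (A : Lorentz.Mat4) (hA : A ∈ Lorentz.SOPlus g)
    (hns : ¬ Lorentz.IsSimpleTransformation g A)
    (hmu : Lorentz.muMinus A ≠ -Real.pi ^ 2) :
    -- the quantities `μ_±`, `c_±`, `s_±` and the quotients below are well defined
    0 ≤ Lorentz.disc A ∧
    1 ≤ (1 / 4) * (A.trace + √(Lorentz.disc A)) ∧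
    (1 / 4) * (A.trace - √(Lorentz.disc A)) ∈ Set.Icc (-1 : ℝ) 1 ∧
    0 < Lorentz.muPlus A ∧ Lorentz.muMinus A < 0 ∧
    (Lorentz.cPlus A - Lorentz.cMinus A) * Lorentz.sPlus A ≠ 0 ∧
    (Lorentz.cPlus A - Lorentz.cMinus A) * Lorentz.sMinus A ≠ 0 ∧
    -- the logarithm and its orthogonal decomposition
    ∃ L Lp Lm : Lorentz.Mat4,
      A = NormedSpace.exp L ∧
      Lorentz.IsNonsimpleBivector g L ∧
      Lorentz.IsOrthogonalDecomposition g L Lp Lm ∧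
      Lp = -((1 / ((Lorentz.cPlus A - Lorentz.cMinus A) * Lorentz.sPlus A)) •
        (((1 / 2) * Lorentz.cMinus A) • (A - A⁻¹) - (1 / 4 : ℝ) • (A ^ 2 - A⁻¹ ^ 2))) ∧
      Lm = (1 / ((Lorentz.cPlus A - Lorentz.cMinus A) * Lorentz.sMinus A)) •
        (((1 / 2) * Lorentz.cPlus A) • (A - A⁻¹) - (1 / 4 : ℝ) • (A ^ 2 - A⁻¹ ^ 2)) ∧
      Lorentz.traceK 2 Lp = -Lorentz.muPlus A ∧
      Lorentz.traceK 2 Lm = -Lorentz.muMinus A := by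
  have hA' : A ∈ Lorentz.SO g := connectedComponentIn_subset _ _ hA
  obtain ⟨hdisc, hp, hq1, hq2, hk⟩ := Lorentz.SO.spectral_bounds hg hA' hns hmu
  refine ⟨hdisc, hp.le, ⟨hq1.le, hq2.le⟩, ?_⟩
  obtain ⟨p, hpd⟩ : ∃ p, p = (1 / 4) * (A.trace + √(Lorentz.disc A)) := ⟨_, rfl⟩
  obtain ⟨q, hqd⟩ : ∃ q, q = (1 / 4) * (A.trace - √(Lorentz.disc A)) := ⟨_, rfl⟩
  have ht : A.trace = 2 * p + 2 * q := by rw [hpd, hqd]; ring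
  simp only [Lorentz.cPlus, Lorentz.cMinus, Lorentz.sPlus, Lorentz.sMinus, Lorentz.muPlus,
    Lorentz.muMinus, neg_neg]
  rw [← hpd] at hp hk
  rw [← hqd] at hq1 hq2 hk
  rw [← hpd, ← hqd]
  have ha : 0 < Real.arcosh p := Real.arcosh_pos hp
  have hcosh : Real.cosh (Real.arcosh p) = p := Real.cosh_arcosh hp.le
  have hb : 0 < Real.arccos q := Real.arccos_pos.2 hq2
  have hcos : Real.cos (Real.arccos q) = q := Real.cos_arccos hq1.le hq2.le
  have hbpi : Real.arccos q < Real.pi := lt_of_le_of_ne (Real.arccos_le_pi q) fun h => by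
    have := Real.arccos_eq_pi.1 h; linarith
  rw [Real.sqrt_sq ha.le, Real.sqrt_sq hb.le, hcosh, hcos]
  generalize Real.arcosh p = a at *
  generalize Real.arccos q = b at *
  have hsinh : 0 < Real.sinh a := Real.sinh_pos_iff.2 ha
  have hsin : 0 < Real.sin b := Real.sin_pos_of_pos_of_lt_pi hb hbpi
  have hsh := Real.cosh_sq a
  have hst := Real.sin_sq_add_cos_sq b
  have hexpa := Lorentz.hasSum_hyperbolic ha.ne'
  have hexpb := Lorentz.hasSum_trigonometric hb.ne'
  rw [hcosh] at hsh hexpa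
  rw [hcos] at hst hexpb
  have hpq : p - q ≠ 0 := by linarith
  refine ⟨by positivity, neg_lt_zero.2 (by positivity), by positivity, by positivity, ?_⟩
  obtain ⟨P, Q, hP, hQ, hsum, hPQ, hQP, hPB, hQB, hS, hBB, hPt, hQt⟩ :=
    Lorentz.SO.exists_projections hg hA' (by linarith) ht hk
  have h1 : A * A⁻¹ = 1 := Matrix.mul_nonsing_inv _ (Lorentz.SO.isUnit_det hA')
  have h2 : A⁻¹ * A = 1 := Matrix.nonsing_inv_mul _ (Lorentz.SO.isUnit_det hA')
  have hSB : A ^ 2 - A⁻¹ ^ 2 = (A + A⁻¹) * (A - A⁻¹) := by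
    simp only [add_mul, mul_sub, h1, h2, sq]
    abel
  have hLpso := Lorentz.SO.selfadjoint_mul_sub_inv_mem_so hA' (2 * q)
  have hLmso := Lorentz.SO.selfadjoint_mul_sub_inv_mem_so hA' (2 * p)
  have hAB : A = (1 / 2 : ℝ) • (A - A⁻¹) + (1 / 2 : ℝ) • (A + A⁻¹) := by module
  rw [hSB]
  generalize A - A⁻¹ = B at *
  have hPP : P * P = P := by
    have := congrArg (P * ·) hsum
    simpa [mul_add, hPQ] using this
  have hQQ : Q * Q = Q := by
    have := congrArg (Q * ·) hsum
    simpa [mul_add, hQP] using this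
  have hPBB : P * (B * B) = (4 * p ^ 2 - 4) • P := by
    rw [hBB, mul_add, mul_smul_comm, mul_smul_comm, hPP, hPQ, smul_zero, add_zero]
  have hQBB : Q * (B * B) = (4 * q ^ 2 - 4) • Q := by
    rw [hBB, mul_add, mul_smul_comm, mul_smul_comm, hQQ, hQP, smul_zero, zero_add]
  have hmul : ∀ X Y : Lorentz.Mat4, Commute Y B → (X * B) * (Y * B) = (X * Y) * (B * B) := by
    intro X Y hY
    rw [Matrix.mul_assoc, ← Matrix.mul_assoc B, ← hY.eq]
    simp only [Matrix.mul_assoc]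
  -- As `p = cosh a` and `q = cos b`, `(PB)² = 4 sinh² a • P` and `(QB)² = -4 sin² b • Q`; the
  -- scalars normalise these squares to `a² • P` and `-b² • Q`.
  obtain ⟨Lp, hLp⟩ : ∃ Lp, Lp = (a / (2 * Real.sinh a)) • (P * B) := ⟨_, rfl⟩
  obtain ⟨Lm, hLm⟩ : ∃ Lm, Lm = (b / (2 * Real.sin b)) • (Q * B) := ⟨_, rfl⟩
  have hpm : Lp * Lm = 0 := by
    rw [hLp, hLm, smul_mul_smul_comm, hmul _ _ hQB, hPQ, zero_mul, smul_zero]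
  have hmp : Lm * Lp = 0 := by
    rw [hLp, hLm, smul_mul_smul_comm, hmul _ _ hPB, hQP, zero_mul, smul_zero]
  have hpp : Lp * Lp = (a ^ 2) • P := by
    rw [hLp, smul_mul_smul_comm, hmul _ _ hPB, hPP, hPBB, smul_smul, hsh]
    congr 1
    field_simp
    ring
  have hmm : Lm * Lm = (-b ^ 2) • Q := by
    rw [hLm, smul_mul_smul_comm, hmul _ _ hQB, hQQ, hQBB, smul_smul, eq_sub_of_add_eq' hst]
    congr 1
    field_simp
    ring
  have hLpP : Lp * P = Lp := by
    rw [hLp, smul_mul_assoc, Matrix.mul_assoc, ← hPB.eq, ← Matrix.mul_assoc, hPP]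
  have hLmQ : Lm * Q = Lm := by
    rw [hLm, smul_mul_assoc, Matrix.mul_assoc, ← hQB.eq, ← Matrix.mul_assoc, hQQ]
  have hp3 : Lp ^ 3 = (a ^ 2) • Lp := by
    rw [pow_succ', sq, hpp, mul_smul_comm, hLpP]
  have hm3 : Lm ^ 3 = (-b ^ 2) • Lm := by
    rw [pow_succ', sq, hmm, mul_smul_comm, hLmQ]
  have hexp : A = NormedSpace.exp (Lp + Lm) := by
    have ep : NormedSpace.exp Lp = 1 + (1 / 2 : ℝ) • (P * B) + (p - 1) • P := by
      rw [Lorentz.matrix_exp_eq_of_cube hp3 hexpa, sq Lp, hpp, hLp, smul_smul, smul_smul]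
      match_scalars <;> field_simp
    have em : NormedSpace.exp Lm = 1 + (1 / 2 : ℝ) • (Q * B) + (q - 1) • Q := by
      rw [Lorentz.matrix_exp_eq_of_cube hm3 hexpb, sq Lm, hmm, hLm, smul_smul, smul_smul]
      match_scalars <;> field_simp
      ring
    have z1 : P * B * Q = 0 := by rw [Matrix.mul_assoc, ← hQB.eq, ← Matrix.mul_assoc, hPQ, zero_mul]
    have z2 : P * B * (Q * B) = 0 := by rw [hmul _ _ hQB, hPQ, zero_mul]
    have z3 : P * (Q * B) = 0 := by rw [← Matrix.mul_assoc, hPQ, zero_mul]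
    rw [Matrix.exp_add_of_commute Lp Lm (hpm.trans hmp.symm), ep, em, hAB, hS]
    have hB : B = P * B + Q * B := by rw [← add_mul, hsum, one_mul]
    simp only [add_mul, mul_add, smul_mul_assoc, mul_smul_comm, z1, z2, z3, hPQ, one_mul, mul_one,
      smul_zero, add_zero]
    nth_rw 1 [hB]
    rw [← hsum]
    module
  obtain ⟨hnon, hdec, hkp, hkm⟩ := Lorentz.isOrthogonalDecomposition_of_projections hg
    (by positivity) (neg_lt_zero.2 (by positivity))
    (by rw [hLp, hP, smul_mul_assoc]; exact Lorentz.so_smul _ (Lorentz.so_smul _ hLpso))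
    (by rw [hLm, hQ, smul_mul_assoc]; exact Lorentz.so_smul _ (Lorentz.so_smul _ hLmso))
    hpm hmp hPQ hQP hsum hpp hmm hLpP hLmQ hPt hQt
  refine ⟨Lp + Lm, Lp, Lm, hexp, hnon, hdec, ?_, ?_, hkp, hkm.trans (neg_neg _)⟩
  · rw [hLp, hP, smul_mul_assoc, sub_mul, smul_mul_assoc, one_mul]
    match_scalars <;> field_simp
    ring
  · rw [hLm, hQ, smul_mul_assoc, sub_mul, smul_mul_assoc, one_mul]
    match_scalars <;> field_simp
    ring
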